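/- Let $n\ge 1$ and $m\ge 0$ be integers, let $M$ be a smooth $n$-dimensional manifold, and let $F:M\to\mathbb{R}^{m+n}$ be a smooth immersion; give $M$ the induced metric. Let $B$ be the second fundamental form, $B(X,Y)=(D_X\,dF(Y))^{\perp}$, a section of $\mathrm{Hom}(\odot^2TM,NM)$ with the connection $\nabla$ induced by the Levi-Civita connection of $TM$ and the normal connection of $NM$; let $H=\operatorname{tr}B=\sum_i B(e_i,e_i)$ be the (unnormalized) mean curvature vector, $\nabla H$ its covariant derivative in the normal bundle, and let $|\cdot|$ be the norms induced by the metrics ($|B|^2=\sum_{i,j}|B(e_i,e_j)|^2$, $|\nabla B|^2=\sum_{i,j,k}|(\nabla_{e_k}B)(e_i,e_j)|^2$, $|\nabla H|^2=\sum_k|\nabla_{e_k}H|^2$ for an orthonormal tangent frame $\{e_i\}$). Then the function $|B|$ is differentiable at every point where $B\neq 0$, and at every point of $M$ where $|B|$ is differentiable the following hold. For every real $\varepsilon>0$, $$|\nabla B|^2\ \ge\ \Bigl(1+\frac{2}{n+\varepsilon}\Bigr)\bigl|\nabla|B|\bigr|^2-C(n,\varepsilon)\,|\nabla H|^2,\qquad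 C(n,\varepsilon)=\frac{2(n-1+\varepsilon)}{\varepsilon(n+\varepsilon)}.$$ If moreover $M$ has parallel mean curvature, i.e. $\nabla H=0$ on all of $M$, then $$|\nabla B|^2\ \ge\ \Bigl(1+\frac{2}{n}\Bigr)\bigl|\nabla|B|\bigr|^2 .$$ -/

import Mathlib

open scoped Manifold ContDiff

/-- An immersed smooth `n`-dimensional submanifold of Euclidean space `ℝ^(m+n)`: a smooth map from
a smooth `n`-manifold `M` whose differential is injective at every point. -/
structure ImmersedSubmanifold (n m : ℕ) (M : Type*) [TopologicalSpace M]
    [ChartedSpace (EuclideanSpace ℝ (Fin n)) M] where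
  /-- the immersion -/
  toFun : M → EuclideanSpace ℝ (Fin (m + n))
  contMDiff : ContMDiff (𝓡 n) 𝓘(ℝ, EuclideanSpace ℝ (Fin (m + n))) ∞ toFun
  injective_deriv : ∀ p, Function.Injective (mvfderiv (𝓡 n) toFun p)

namespace ImmersedSubmanifold

noncomputable section

variable {n m : ℕ} {M : Type*} [TopologicalSpace M] [ChartedSpace (EuclideanSpace ℝ (Fin n)) M]
  (S : ImmersedSubmanifold n m M)

/-- The differential `dF_p : T_p M → ℝ^(m+n)` of the immersion. -/
def dF (p : M) : TangentSpace (𝓡 n) p →L[ℝ] EuclideanSpace ℝ (Fin (m + n)) :=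
  mvfderiv (𝓡 n) S.toFun p

/-- The tangent plane `dF_p (T_p M)` inside `ℝ^(m+n)`. Its orthogonal complement is the normal
space `N_p M`. -/
def tangentPlane (p : M) : Submodule ℝ (EuclideanSpace ℝ (Fin (m + n))) :=
  LinearMap.range (S.dF p).toLinearMap

/-- The differential as an isomorphism of `T_p M` onto the tangent plane. -/
def tangentEquiv (p : M) : TangentSpace (𝓡 n) p ≃ₗ[ℝ] S.tangentPlane p :=
  LinearEquiv.ofInjective (S.dF p).toLinearMap (S.injective_deriv p)

theorem finrank_tangentPlane (p : M) : Module.finrank ℝ (S.tangentPlane p) = n := by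
  rw [← (S.tangentEquiv p).finrank_eq]
  exact finrank_euclideanSpace_fin (𝕜 := ℝ) (n := n)

/-- The tangential part of a vector of `ℝ^(m+n)`, as an element of `T_p M`. -/
def tangentialPart (p : M) (v : EuclideanSpace ℝ (Fin (m + n))) : TangentSpace (𝓡 n) p :=
  (S.tangentEquiv p).symm ((S.tangentPlane p).orthogonalProjectionOnto v)

/-- The normal part of a vector of `ℝ^(m+n)`. -/
def normalPart (p : M) (v : EuclideanSpace ℝ (Fin (m + n))) : EuclideanSpace ℝ (Fin (m + n)) :=
  (S.tangentPlane p)ᗮ.starProjection v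

/-- A basis of `T_p M` that is orthonormal for the induced metric
`g_p (u, w) = ⟪dF_p u, dF_p w⟫`. The traces and norms below do not depend on its choice. -/
def frame (p : M) (i : Fin n) : TangentSpace (𝓡 n) p :=
  (S.tangentEquiv p).symm
    ((stdOrthonormalBasis ℝ (S.tangentPlane p)).reindex (finCongr (S.finrank_tangentPlane p)) i)

/-- The derivative at `p` in the ambient space, in the direction `u`, of the tangent vector field
`Y`, which is regarded as the `ℝ^(m+n)`-valued function `q ↦ dF_q (Y q)`. -/
def ambientDeriv (Y : (q : M) → TangentSpace (𝓡 n) q) (p : M) (u : TangentSpace (𝓡 n) p) :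
    EuclideanSpace ℝ (Fin (m + n)) :=
  mvfderiv (𝓡 n) (fun q ↦ S.dF q (Y q)) p u

/-- The Levi-Civita connection of the induced metric: `∇_u Y` is the tangential part of the
ambient derivative. -/
def tangentConnection (Y : (q : M) → TangentSpace (𝓡 n) q) (p : M) (u : TangentSpace (𝓡 n) p) :
    TangentSpace (𝓡 n) p :=
  S.tangentialPart p (S.ambientDeriv Y p u)

/-- The connection of the normal bundle: `∇_u ν` is the normal part of the ambient derivative of
the normal field `ν`. -/
def normalConnection (ν : M → EuclideanSpace ℝ (Fin (m + n))) (p : M)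
    (u : TangentSpace (𝓡 n) p) : EuclideanSpace ℝ (Fin (m + n)) :=
  S.normalPart p (mvfderiv (𝓡 n) ν p u)

variable [IsManifold (𝓡 n) ∞ M]

/-- A tangent vector field near `p` with value `w` at `p`, smooth near `p`. -/
def extendVector {p : M} (w : TangentSpace (𝓡 n) p) :
    (q : M) → TangentSpace (𝓡 n) q :=
  FiberBundle.extend (EuclideanSpace ℝ (Fin n)) w

/-- The second fundamental form `B_p (u, w) = (D_u W)^⊥`, where the vector field `W` extends `w`
(the result does not depend on the extension). -/
def secondFundamentalForm (p : M) (u w : TangentSpace (𝓡 n) p) :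
    EuclideanSpace ℝ (Fin (m + n)) :=
  S.normalPart p (S.ambientDeriv (extendVector w) p u)

/-- The covariant derivative of the second fundamental form for the connection of
`Hom(⊙²TM, NM)` induced from those of `TM` and `NM`:
`(∇_u B)(v, w) = ∇_u (B(V, W)) - B(∇_u V, w) - B(v, ∇_u W)`, where the vector fields `V` and `W`
extend `v` and `w` (the result does not depend on the extensions). -/
def nablaB (p : M) (u v w : TangentSpace (𝓡 n) p) : EuclideanSpace ℝ (Fin (m + n)) :=
  S.normalConnection
      (fun q ↦ S.secondFundamentalForm q (extendVector v q) (extendVector w q)) p u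
    - S.secondFundamentalForm p (S.tangentConnection (extendVector v) p u) w
    - S.secondFundamentalForm p v (S.tangentConnection (extendVector w) p u)

/-- The mean curvature vector, the (unnormalized) trace of the second fundamental form. -/
def meanCurvature (p : M) : EuclideanSpace ℝ (Fin (m + n)) :=
  ∑ i, S.secondFundamentalForm p (S.frame p i) (S.frame p i)

/-- The mean curvature vector is parallel in the normal bundle. -/
def HasParallelMeanCurvature : Prop :=
  ∀ (p : M) (u : TangentSpace (𝓡 n) p), S.normalConnection S.meanCurvature p u = 0

/-- The norm `|B|` of the second fundamental form. -/
def normB (p : M) : ℝ :=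
  √(∑ i, ∑ j, ‖S.secondFundamentalForm p (S.frame p i) (S.frame p j)‖ ^ 2)

/-- The squared norm `|∇B|²`. -/
def normSqNablaB (p : M) : ℝ :=
  ∑ k, ∑ i, ∑ j, ‖S.nablaB p (S.frame p k) (S.frame p i) (S.frame p j)‖ ^ 2

/-- The squared norm `|∇H|²`. -/
def normSqNablaH (p : M) : ℝ :=
  ∑ k, ‖S.normalConnection S.meanCurvature p (S.frame p k)‖ ^ 2

/-- The squared norm `|∇f|²`, for the induced metric, of the gradient of a function `f` that is
differentiable at `p`. -/
def normSqGrad (f : M → ℝ) (p : M) : ℝ :=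
  ∑ k, (mvfderiv (𝓡 n) f p (S.frame p k)) ^ 2

end

end ImmersedSubmanifold

/-! By the Codazzi equation in flat space, `∇B` is a totally symmetric three-tensor `T` with normal
values (`nablaB_swap_left`, `nablaB_swap_right`), and its trace over the last two slots is `∇H`
(`normalConnection_meanCurvature`). Differentiating `|B|²` gives `|B| d|B|(u) = ⟨B, ∇_u B⟩`, so by
Cauchy–Schwarz `|∇|B||` is at most the norm of the slice `∇_c B`, where `c` is the unit vector along
the gradient. Where `|B|` vanishes and is differentiable, it has a minimum, and its gradient is
zero.

It remains to bound one slice of `T` by all of `T`. In an orthonormal frame starting with `c`, write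
`X`, `Y`, `Z`, `Q` for the sums of `‖T_abc‖²` over `T_000`, `T_00i`, `T_0ij`, `T_aij` with `a, i, j
> 0`. The slice has norm squared `X + 2Y + Z`, whereas symmetry gives `X + 3Y + 3Z + Q` for the
whole tensor. The trace expresses `T_000` through the `T_0ii` and `T_00a` through the `T_aii`, up to
`∇H`; this bounds `X` by `Z` and `Y` by `Q` (`symmetric_tensor_slice_bound`). Young's inequality
with parameter `ε` absorbs `∇H`; when `∇H = 0`, let `ε → 0`.

The geometric half is a computation in charts. The pointwise frames need not vary continuously, so
traces are differentiated in a fixed orthonormal basis of the ambient space, with `B` extended by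
zero to normal vectors. -/

/-! ### The algebraic inequality for symmetric three-tensors -/

section Kato

variable {W : Type*} [NormedAddCommGroup W]

/-- Young's inequality for the cross term `2‖h‖‖s‖`. -/
theorem norm_sq_sub_le_of_norm_sq_le {h s : W} {k D ε : ℝ} (hε : 0 < ε) (hk : 0 ≤ k) (hD : 0 ≤ D)
    (hs : ‖s‖ ^ 2 ≤ k * D) : ‖h - s‖ ^ 2 ≤ (k + ε) * (‖h‖ ^ 2 / ε + D) := by
  have h1 : ‖h - s‖ ^ 2 ≤ (‖h‖ + ‖s‖) ^ 2 := by
    gcongr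
    exact norm_sub_le h s
  set a := ‖h‖
  set b := ‖s‖
  have ha : 0 ≤ a := norm_nonneg h
  have hb : 0 ≤ b := norm_nonneg s
  -- AM-GM for the two terms on the right, whose product is `a² k D`. Comparing squares avoids
  -- dividing by `k`, which may be zero.
  have h2 : 2 * a * b ≤ a ^ 2 * k / ε + ε * D := by
    apply le_of_sq_le_sq _ (by positivity)
    have e : (a ^ 2 * k / ε + ε * D) ^ 2 = (a ^ 2 * k / ε - ε * D) ^ 2 + 4 * a ^ 2 * (k * D) := by
      field_simp
      ring
    rw [e]
    nlinarith [sq_nonneg (a ^ 2 * k / ε - ε * D), mul_le_mul_of_nonneg_left hs (sq_nonneg a)]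
  have e : (k + ε) * (a ^ 2 / ε + D) = a ^ 2 * k / ε + ε * D + a ^ 2 + k * D := by
    field_simp
    ring
  rw [e]
  nlinarith

theorem norm_sq_sum_le_card_mul {k : ℕ} (z : Fin k → W) :
    ‖∑ i, z i‖ ^ 2 ≤ k * ∑ i, ‖z i‖ ^ 2 := by
  calc ‖∑ i, z i‖ ^ 2 ≤ (∑ i, ‖z i‖) ^ 2 := by
        gcongr
        exact norm_sum_le _ _
    _ ≤ _ := by simpa using sq_sum_le_card_mul_sum_sq (s := Finset.univ) (f := fun i ↦ ‖z i‖)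

/-- Here `k = n - 1`. After multiplication by `k + 1 + ε` the claim splits: the part in `X`, `Z`,
`h₀` is exactly twice `bX`, which fixes the constants, and the part in `Y`, `Q`, `h₁` is `key`,
which has slack. -/
theorem slice_bound_arithmetic {k : ℕ} {X Y Z Q h₀ h₁ ε : ℝ} (hε : 0 < ε) (hk : k = 0 → Y = 0)
    (hY : 0 ≤ Y) (hQ : 0 ≤ Q) (h₁_nonneg : 0 ≤ h₁)
    (bX : X ≤ (k + ε) * (h₀ / ε + Z)) (bY : Y ≤ (k + ε) * (h₁ / ε + Q)) :
    (1 + 2 / ((k : ℝ) + 1 + ε)) * (X + 2 * Y + Z) ≤ X + 3 * Y + 3 * Z + Q +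
      2 * ((k : ℝ) + ε) / (ε * ((k : ℝ) + 1 + ε)) * (h₀ + h₁) := by
  have hq : 0 ≤ h₁ / ε := by positivity
  have key : 4 * Y ≤ (k + 1 + ε) * (Y + Q) + 2 * (k + ε) * (h₁ / ε) := by
    rcases Nat.eq_zero_or_pos k with h | hkpos
    · rw [hk h, mul_zero]
      positivity
    · have hk1 : (1 : ℝ) ≤ k := by exact_mod_cast hkpos
      generalize h₁ / ε = q at *
      obtain ⟨t, ht⟩ : ∃ t : ℝ, t = k + ε := ⟨_, rfl⟩
      have ht1 : 1 < t := by linarith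
      have e : (k : ℝ) + 1 + ε = t + 1 := by rw [ht]; ring
      rw [e, ← ht]
      rw [← ht] at bY
      -- The claim is `(3 - t) Y ≤ (t + 1) Q + 2 t q`. For `t ≤ 3`, multiplying `bY` by `3 - t`
      -- leaves the surplus `(t - 1)² Q + t (t - 1) q`, nonnegative because `t > 1`; this is why `k
      -- = 0` was treated apart.
      rcases le_total 3 t with h | h
      · have b1 := mul_nonneg (by linarith : 0 ≤ t - 3) hY
        have b2 : 0 ≤ (t + 1) * Q := by positivity
        have b3 : 0 ≤ 2 * t * q := by positivity
        linarith
      · have b1 := mul_le_mul_of_nonneg_left bY (by linarith : 0 ≤ 3 - t)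
        have b2 : 0 ≤ (t - 1) ^ 2 * Q := by positivity
        have b3 : 0 ≤ (t - 1) * (t * q) := mul_nonneg (by linarith) (by positivity)
        linarith
  have hN : (0 : ℝ) < k + 1 + ε := by positivity
  have h : 2 * (X + 2 * Y + Z) ≤
      (k + 1 + ε) * (Y + 2 * Z + Q) + 2 * (k + ε) / ε * (h₀ + h₁) := by
    have e : 2 * ((k : ℝ) + ε) / ε * (h₀ + h₁) =
        2 * ((k + ε) * (h₀ / ε)) + 2 * (k + ε) * (h₁ / ε) := by
      field_simp
    rw [e]
    linarith
  have h' := div_le_div_of_nonneg_right h hN.le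
  have f1 : 2 * (X + 2 * Y + Z) / ((k : ℝ) + 1 + ε) =
      2 / ((k : ℝ) + 1 + ε) * (X + 2 * Y + Z) := by ring
  have f2 : (((k : ℝ) + 1 + ε) * (Y + 2 * Z + Q) + 2 * (k + ε) / ε * (h₀ + h₁)) / (k + 1 + ε) =
      Y + 2 * Z + Q + 2 * ((k : ℝ) + ε) / (ε * ((k : ℝ) + 1 + ε)) * (h₀ + h₁) := by
    field_simp
  rw [f1, f2] at h'
  linarith

/-- The refined Kato inequality in a frame whose first vector is the direction of the slice. -/
theorem symmetric_tensor_slice_bound {k : ℕ} (T : Fin (k + 1) → Fin (k + 1) → Fin (k + 1) → W)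
    (h12 : ∀ a b c, T a b c = T b a c) (h23 : ∀ a b c, T a b c = T a c b) {ε : ℝ} (hε : 0 < ε) :
    (1 + 2 / ((k : ℝ) + 1 + ε)) * ∑ i, ∑ j, ‖T 0 i j‖ ^ 2 ≤
      ∑ a, ∑ i, ∑ j, ‖T a i j‖ ^ 2 +
        2 * ((k : ℝ) + ε) / (ε * ((k : ℝ) + 1 + ε)) * ∑ a, ‖∑ i, T a i i‖ ^ 2 := by
  set X := ‖T 0 0 0‖ ^ 2 with hX
  set Y := ∑ i : Fin k, ‖T 0 0 i.succ‖ ^ 2 with hY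
  set Z := ∑ i : Fin k, ∑ j : Fin k, ‖T 0 i.succ j.succ‖ ^ 2 with hZ
  set Q := ∑ a : Fin k, ∑ i : Fin k, ∑ j : Fin k, ‖T a.succ i.succ j.succ‖ ^ 2 with hQ
  set h0 := ‖∑ i, T 0 i i‖ ^ 2 with hh0
  set h1 := ∑ a : Fin k, ‖∑ i, T a.succ i i‖ ^ 2 with hh1
  have hY0 : 0 ≤ Y := Finset.sum_nonneg fun _ _ ↦ sq_nonneg _
  have hZ0 : 0 ≤ Z := Finset.sum_nonneg fun _ _ ↦ Finset.sum_nonneg fun _ _ ↦ sq_nonneg _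
  have hQ0 : 0 ≤ Q := Finset.sum_nonneg fun _ _ ↦ Finset.sum_nonneg fun _ _ ↦
    Finset.sum_nonneg fun _ _ ↦ sq_nonneg _
  have hh10 : 0 ≤ h1 := Finset.sum_nonneg fun _ _ ↦ sq_nonneg _
  have e1 : ∑ i, ∑ j, ‖T 0 i j‖ ^ 2 = X + 2 * Y + Z := by
    simp only [Fin.sum_univ_succ, Finset.sum_add_distrib]
    simp only [h23 0 _ 0]
    ring
  have e2 : ∑ a, ∑ i, ∑ j, ‖T a i j‖ ^ 2 = X + 3 * Y + 3 * Z + Q := by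
    rw [Fin.sum_univ_succ, e1]
    simp only [Fin.sum_univ_succ, Finset.sum_add_distrib]
    have a1 : ∀ a : Fin k, T a.succ 0 0 = T 0 0 a.succ := fun a ↦ by rw [h12, h23]
    have a2 : ∀ a j : Fin k, T a.succ 0 j.succ = T 0 a.succ j.succ := fun a j ↦ by rw [h12]
    have a3 : ∀ a j : Fin k, T a.succ j.succ 0 = T 0 a.succ j.succ := fun a j ↦ by rw [h23, h12]
    simp only [a1, a2, a3]
    ring
  have e3 : ∑ a, ‖∑ i, T a i i‖ ^ 2 = h0 + h1 := by
    rw [Fin.sum_univ_succ]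
  have hk : (0 : ℝ) ≤ k := Nat.cast_nonneg k
  have bX : X ≤ (k + ε) * (h0 / ε + Z) := by
    -- The trace is solved for its first diagonal entry; the remaining `k` diagonal entries are
    -- controlled by Cauchy–Schwarz.
    have e : T 0 0 0 = ∑ i, T 0 i i - ∑ i : Fin k, T 0 i.succ i.succ := by
      rw [Fin.sum_univ_succ]
      abel
    rw [hX, e]
    refine norm_sq_sub_le_of_norm_sq_le hε hk hZ0 ((norm_sq_sum_le_card_mul _).trans ?_)
    refine mul_le_mul_of_nonneg_left (Finset.sum_le_sum fun i _ ↦ ?_) hk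
    exact Finset.single_le_sum (f := fun j : Fin k ↦ ‖T 0 i.succ j.succ‖ ^ 2)
      (fun _ _ ↦ sq_nonneg _) (Finset.mem_univ i)
  have bY : Y ≤ (k + ε) * (h1 / ε + Q) := by
    have : ∀ a : Fin k, ‖T 0 0 a.succ‖ ^ 2 ≤ (k + ε) * (‖∑ i, T a.succ i i‖ ^ 2 / ε +
        ∑ i : Fin k, ∑ j : Fin k, ‖T a.succ i.succ j.succ‖ ^ 2) := by
      intro a
      have e : T 0 0 a.succ =
          ∑ i, T a.succ i i - ∑ i : Fin k, T a.succ i.succ i.succ := by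
        rw [Fin.sum_univ_succ, h12 a.succ, h23 0 a.succ]
        abel
      rw [e]
      refine norm_sq_sub_le_of_norm_sq_le hε hk
        (Finset.sum_nonneg fun _ _ ↦ Finset.sum_nonneg fun _ _ ↦ sq_nonneg _)
        ((norm_sq_sum_le_card_mul _).trans ?_)
      refine mul_le_mul_of_nonneg_left (Finset.sum_le_sum fun i _ ↦ ?_) hk
      exact Finset.single_le_sum (f := fun j : Fin k ↦ ‖T a.succ i.succ j.succ‖ ^ 2)
        (fun _ _ ↦ sq_nonneg _) (Finset.mem_univ i)
    refine (Finset.sum_le_sum fun a _ ↦ this a).trans_eq ?_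
    rw [← Finset.mul_sum, Finset.sum_add_distrib, ← Finset.sum_div]
  rw [e1, e2, e3]
  refine slice_bound_arithmetic hε ?_ hY0 hQ0 hh10 bX bY
  rintro rfl
  simp [hY]

/-! ### Change of orthonormal basis. -/

variable [InnerProductSpace ℝ W]

open scoped RealInnerProductSpace

/-- Expand each `e i` in `e'` and apply Parseval to the coefficients. Values in a module `F` cover
both the vector-valued trace `H` and, through inner products, squared norms. -/
theorem OrthonormalBasis.sum_bilin_eq {ι κ V F : Type*} [Fintype ι] [Fintype κ]
    [NormedAddCommGroup V] [InnerProductSpace ℝ V] [AddCommGroup F] [Module ℝ F]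
    (e : OrthonormalBasis ι ℝ V) (e' : OrthonormalBasis κ ℝ V) (β : V →ₗ[ℝ] V →ₗ[ℝ] F) :
    ∑ i, β (e i) (e i) = ∑ j, β (e' j) (e' j) := by
  classical
  have h : ∀ i, β (e i) (e i) =
      ∑ j, ∑ l, (⟪e' j, e i⟫ * ⟪e i, e' l⟫) • β (e' j) (e' l) := by
    intro i
    conv_lhs => rw [← e'.sum_repr (e i)]
    simp only [map_sum, LinearMap.sum_apply, map_smul, LinearMap.smul_apply,
      OrthonormalBasis.repr_apply_apply, Finset.smul_sum, smul_smul]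
    rw [Finset.sum_comm]
    refine Finset.sum_congr rfl fun j _ ↦ Finset.sum_congr rfl fun l _ ↦ ?_
    rw [real_inner_comm (e i) (e' l), mul_comm]
  simp only [h]
  rw [Finset.sum_comm]
  refine Finset.sum_congr rfl fun j _ ↦ ?_
  rw [Finset.sum_comm]
  simp only [← Finset.sum_smul, e.sum_inner_mul_inner]
  simp [orthonormal_iff_ite.mp e'.orthonormal]

/-- The expansion of a linear combination of vectors, as a linear map of its coefficients. -/
noncomputable def combination {n : ℕ} (x : Fin n → W) : EuclideanSpace ℝ (Fin n) →ₗ[ℝ] W where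
  toFun c := ∑ k, c k • x k
  map_add' c d := by simp [add_smul, Finset.sum_add_distrib]
  map_smul' r c := by simp [Finset.smul_sum, smul_smul]

theorem combination_single {n : ℕ} (x : Fin n → W) (k : Fin n) :
    combination x (EuclideanSpace.basisFun (Fin n) ℝ k) = x k := by
  simp [combination]

theorem sum_norm_sq_combination {n : ℕ} (x : Fin n → W)
    (e : OrthonormalBasis (Fin n) ℝ (EuclideanSpace ℝ (Fin n))) :
    ∑ a, ‖combination x (e a)‖ ^ 2 = ∑ k, ‖x k‖ ^ 2 := by
  have := e.sum_bilin_eq (EuclideanSpace.basisFun (Fin n) ℝ)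
    ((innerₗ W).compl₁₂ (combination x) (combination x))
  simp only [LinearMap.compl₁₂_apply, combination_single, innerₗ_apply_apply,
    real_inner_self_eq_norm_sq] at this
  exact this

theorem sum_combination_combination {n : ℕ} (x : Fin n → Fin n → W)
    (e : OrthonormalBasis (Fin n) ℝ (EuclideanSpace ℝ (Fin n))) :
    ∑ a, combination (fun k ↦ combination (x k) (e a)) (e a) = ∑ k, x k k := by
  have := e.sum_bilin_eq (EuclideanSpace.basisFun (Fin n) ℝ)
    (LinearMap.mk₂ ℝ (fun c d ↦ combination (fun k ↦ combination (x k) d) c)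
      (by intros; simp) (by intros; simp)
      (by intros; simp [combination, add_smul, Finset.sum_add_distrib])
      (by intros; simp [combination, Finset.smul_sum, smul_smul, mul_left_comm]))
  simp only [LinearMap.mk₂_apply, combination_single] at this
  exact this

theorem combination_comm {n : ℕ} (x : Fin n → Fin n → W) (c d : EuclideanSpace ℝ (Fin n)) :
    combination (fun k ↦ combination (x k) d) c =
      combination (fun k ↦ combination (fun l ↦ x l k) c) d := by
  simp only [combination, LinearMap.coe_mk, AddHom.coe_mk, Finset.smul_sum, smul_smul]
  rw [Finset.sum_comm]
  simp only [mul_comm]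

theorem combination_sum {n : ℕ} {ι : Type*} (s : Finset ι) (x : ι → Fin n → W)
    (c : EuclideanSpace ℝ (Fin n)) :
    combination (fun k ↦ ∑ i ∈ s, x i k) c = ∑ i ∈ s, combination (x i) c := by
  simp only [combination, LinearMap.coe_mk, AddHom.coe_mk, Finset.smul_sum]
  rw [Finset.sum_comm]

/-- The slice bound for the slice of a symmetric tensor in an arbitrary unit direction. -/
theorem symmetric_tensor_direction_bound {n : ℕ} (T : Fin n → Fin n → Fin n → W)
    (h12 : ∀ a b c, T a b c = T b a c) (h23 : ∀ a b c, T a b c = T a c b) {ε : ℝ} (hε : 0 < ε)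
    (c : EuclideanSpace ℝ (Fin n)) (hc : ‖c‖ = 1) :
    (1 + 2 / ((n : ℝ) + ε)) * ∑ i, ∑ j, ‖∑ k, c k • T k i j‖ ^ 2 ≤
      ∑ a, ∑ i, ∑ j, ‖T a i j‖ ^ 2 +
        2 * ((n : ℝ) - 1 + ε) / (ε * ((n : ℝ) + ε)) * ∑ a, ‖∑ i, T a i i‖ ^ 2 := by
  obtain _ | k := n
  · have : c = 0 := Subsingleton.elim _ _
    simp [this] at hc
  -- An orthonormal basis with `e 0 = c`: only the value at the index `0` is prescribed.
  obtain ⟨e, he⟩ := Orthonormal.exists_orthonormalBasis_extension_of_card_eq (𝕜 := ℝ)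
    (E := EuclideanSpace ℝ (Fin (k + 1))) (ι := Fin (k + 1)) (by simp)
    (v := fun _ ↦ c) (s := {0}) (by
      rw [orthonormal_iff_ite]
      rintro ⟨i, hi⟩ ⟨j, hj⟩
      simp only [Set.mem_singleton_iff] at hi hj
      subst hi hj
      simp [hc])
  have he0 : e 0 = c := he 0 rfl
  set T' : Fin (k + 1) → Fin (k + 1) → Fin (k + 1) → W := fun a i j ↦
    combination (fun a' ↦ combination (fun i' ↦ combination (T a' i') (e j)) (e i)) (e a) with hT'
  -- Rotating the last two slots does not change the norm of a slice; at `a = 0` this is the slice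
  -- in the direction `c`.
  have n3 : ∀ a, ∑ i, ∑ j, ‖T' a i j‖ ^ 2 = ∑ i, ∑ j, ‖combination (fun l ↦ T l i j) (e a)‖ ^ 2 := by
    intro a
    have s1 : ∀ i j, T' a i j = combination (fun i' ↦
        combination (fun j' ↦ combination (fun a' ↦ T a' i' j') (e a)) (e j)) (e i) := by
      intro i j
      rw [hT']
      simp only []
      rw [combination_comm]
      congr 2
      funext i'
      rw [combination_comm]
    simp only [s1]
    rw [Finset.sum_comm]
    simp only [sum_norm_sq_combination]
    rw [Finset.sum_comm]
    simp only [sum_norm_sq_combination]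
  have n1 : ∑ a, ∑ i, ∑ j, ‖T' a i j‖ ^ 2 = ∑ a, ∑ i, ∑ j, ‖T a i j‖ ^ 2 := by
    simp only [n3]
    rw [Finset.sum_comm]
    conv_rhs => rw [Finset.sum_comm]
    refine Finset.sum_congr rfl fun i _ ↦ ?_
    rw [Finset.sum_comm]
    conv_rhs => rw [Finset.sum_comm]
    simp only [sum_norm_sq_combination]
  have n2 : ∑ a, ‖∑ i, T' a i i‖ ^ 2 = ∑ a, ‖∑ i, T a i i‖ ^ 2 := by
    rw [← sum_norm_sq_combination (fun a ↦ ∑ i, T a i i) e]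
    refine Finset.sum_congr rfl fun a _ ↦ ?_
    rw [hT']
    simp only []
    rw [← combination_sum]
    simp only [sum_combination_combination]
  have := symmetric_tensor_slice_bound T'
    (fun a b c ↦ by
      simp only [hT']
      rw [combination_comm]
      congr 2
      funext k
      congr 2
      funext l
      rw [funext (h12 l k)])
    (fun a b c ↦ by
      simp only [hT']
      congr 2
      funext a'
      rw [combination_comm]
      congr 2
      funext k
      congr 2
      funext l
      exact h23 _ _ _)
    hε
  rw [n1, n2, n3, he0] at this
  have f : ((k + 1 : ℕ) : ℝ) - 1 = k := by push_cast; ring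
  rw [f]
  push_cast
  exact this

/-- The refined Kato inequality for a symmetric three-tensor `T` paired with a two-tensor `b`. -/
theorem symmetric_tensor_kato {n : ℕ} (T : Fin n → Fin n → Fin n → W)
    (h12 : ∀ a b c, T a b c = T b a c) (h23 : ∀ a b c, T a b c = T a c b) {ε : ℝ} (hε : 0 < ε)
    (hn : 1 ≤ n) (b : Fin n → Fin n → W) (r : ℝ) (hr : r ≠ 0)
    (hb : ∑ i, ∑ j, ‖b i j‖ ^ 2 = r ^ 2) (a : Fin n → ℝ)
    (ha : ∀ k, r * a k = ∑ i, ∑ j, ⟪b i j, T k i j⟫) :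
    (1 + 2 / ((n : ℝ) + ε)) * ∑ k, a k ^ 2 ≤
      ∑ a, ∑ i, ∑ j, ‖T a i j‖ ^ 2 +
        2 * ((n : ℝ) - 1 + ε) / (ε * ((n : ℝ) + ε)) * ∑ a, ‖∑ i, T a i i‖ ^ 2 := by
  have hn' : (0 : ℝ) ≤ n - 1 := by
    have : (1 : ℝ) ≤ n := by exact_mod_cast hn
    linarith
  set s := √(∑ k, a k ^ 2) with hs
  have hs2 : s ^ 2 = ∑ k, a k ^ 2 := Real.sq_sqrt (Finset.sum_nonneg fun _ _ ↦ sq_nonneg _)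
  by_cases h0 : s = 0
  · rw [← hs2, h0]
    have : 0 ≤ 2 * ((n : ℝ) - 1 + ε) / (ε * ((n : ℝ) + ε)) := by positivity
    have h2 : 0 ≤ ∑ a, ∑ i, ∑ j, ‖T a i j‖ ^ 2 := Finset.sum_nonneg fun _ _ ↦
      Finset.sum_nonneg fun _ _ ↦ Finset.sum_nonneg fun _ _ ↦ sq_nonneg _
    have h3 : 0 ≤ ∑ a, ‖∑ i, T a i i‖ ^ 2 := Finset.sum_nonneg fun _ _ ↦ sq_nonneg _
    simpa using add_nonneg h2 (mul_nonneg this h3)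
  have hspos : 0 < s := lt_of_le_of_ne (Real.sqrt_nonneg _) (Ne.symm h0)
  set c : EuclideanSpace ℝ (Fin n) := WithLp.toLp 2 (fun k ↦ a k / s) with hc
  have hc1 : ‖c‖ = 1 := by
    rw [EuclideanSpace.norm_eq, Real.sqrt_eq_one]
    simp only [hc, Real.norm_eq_abs, sq_abs, div_pow]
    rw [← Finset.sum_div, ← hs2, div_self (by positivity)]
  refine le_trans ?_ (symmetric_tensor_direction_bound T h12 h23 hε c hc1)
  refine mul_le_mul_of_nonneg_left ?_ (by positivity)
  -- `s` is the derivative in its own unit direction `c`. Cauchy–Schwarz over the pairs `(i, j)`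
  -- then gives `r² s² ≤ r² D`, and `r ≠ 0` cancels.
  have h1 : r * s = ∑ i, ∑ j, ⟪b i j, ∑ k, c k • T k i j⟫ := by
    calc r * s = ∑ k, c k * (r * a k) := by
          have : ∀ k, c k * (r * a k) = r / s * a k ^ 2 := by
            intro k
            simp only [hc]
            ring
          simp only [this]
          rw [← Finset.mul_sum, ← hs2]
          field_simp
      _ = _ := by
          simp only [ha, inner_sum, inner_smul_right, Finset.mul_sum]
          rw [Finset.sum_comm]
          refine Finset.sum_congr rfl fun i _ ↦ ?_
          rw [Finset.sum_comm]
  set D := ∑ i, ∑ j, ‖∑ k, c k • T k i j‖ ^ 2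
  have h2 : (r * s) ^ 2 ≤ r ^ 2 * D := by
    rw [h1, ← hb]
    simp only [D, ← Finset.sum_product', Finset.univ_product_univ]
    refine le_trans ?_ (Finset.sum_mul_sq_le_sq_mul_sq _ _ _)
    refine sq_le_sq.mpr ?_
    refine (Finset.abs_sum_le_sum_abs _ _).trans ((Finset.sum_le_sum fun x _ ↦
      abs_real_inner_le_norm _ _).trans (le_abs_self _))
  rw [mul_pow] at h2
  rw [← hs2]
  exact le_of_mul_le_mul_left h2 (by positivity)

end Kato

/-! ### The second fundamental form of a parametrized submanifold

Here `A` is the derivative of a parametrization and `R` a field of left inverses of `A`. -/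

section Parametrized

variable {V E : Type*} [NormedAddCommGroup V] [NormedSpace ℝ V] [NormedAddCommGroup E]
  [NormedSpace ℝ E] {A : V → V →L[ℝ] E} {R : V → E →L[ℝ] V} {x : V}

variable (A R) in
/-- The projection `1 - A R` along the range of `A`. -/
def complProj (x : V) : E →L[ℝ] E := ContinuousLinearMap.id ℝ E - (A x).comp (R x)

variable (A R) in
/-- The component complementary to the range of `A` of the derivative of `A`. -/
noncomputable def normalHess (x : V) (v w : V) : E := complProj A R x (fderiv ℝ A x v w)

variable (A R) in
/-- The covariant derivative of the second fundamental form, in its totally symmetric form. -/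
noncomputable def normalCubic (x : V) (u v w : V) : E :=
  complProj A R x (fderiv ℝ (fderiv ℝ A) x u v w
    - fderiv ℝ A x u (R x (fderiv ℝ A x v w))
    - fderiv ℝ A x v (R x (fderiv ℝ A x u w))
    - fderiv ℝ A x w (R x (fderiv ℝ A x u v)))

theorem complProj_apply (y : E) : complProj A R x y = y - A x (R x y) := rfl

theorem complProj_apply_of_leftInverse (h : (R x).comp (A x) = ContinuousLinearMap.id ℝ V) (v : V) :
    complProj A R x (A x v) = 0 := by
  have := congrArg (fun L ↦ A x (L v)) h
  simp only [ContinuousLinearMap.comp_apply, ContinuousLinearMap.id_apply] at this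
  rw [complProj_apply, this, sub_self]

theorem hasFDerivAt_normalHess (hA : DifferentiableAt ℝ A x)
    (hA' : DifferentiableAt ℝ (fderiv ℝ A) x) (hR : DifferentiableAt ℝ R x) {v w : V → V}
    (hv : DifferentiableAt ℝ v x) (hw : DifferentiableAt ℝ w x) :
    DifferentiableAt ℝ (fun z ↦ normalHess A R z (v z) (w z)) x ∧ ∀ u,
      fderiv ℝ (fun z ↦ normalHess A R z (v z) (w z)) x u =
        complProj A R x (fderiv ℝ (fderiv ℝ A) x u (v x) (w x)
          + fderiv ℝ A x (fderiv ℝ v x u) (w x) + fderiv ℝ A x (v x) (fderiv ℝ w x u))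
        - fderiv ℝ A x u (R x (fderiv ℝ A x (v x) (w x)))
        - A x (fderiv ℝ R x u (fderiv ℝ A x (v x) (w x))) := by
  have h1 := (hA'.hasFDerivAt.clm_apply hv.hasFDerivAt).clm_apply hw.hasFDerivAt
  have h2 := h1.sub (hA.hasFDerivAt.clm_apply (hR.hasFDerivAt.clm_apply h1))
  refine ⟨h2.differentiableAt, fun u ↦ ?_⟩
  have h3 : HasFDerivAt (fun z ↦ normalHess A R z (v z) (w z)) _ x := h2
  rw [h3.fderiv]
  simp only [complProj_apply, add_apply, sub_apply,
    ContinuousLinearMap.comp_apply, ContinuousLinearMap.flip_apply, map_add]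
  abel

/-- Differentiate `R A v = v`. -/
theorem fderiv_leftInverse_apply (hA : DifferentiableAt ℝ A x) (hR : DifferentiableAt ℝ R x)
    (hRA : ∀ᶠ z in nhds x, (R z).comp (A z) = ContinuousLinearMap.id ℝ V) (u v : V) :
    fderiv ℝ R x u (A x v) = - R x (fderiv ℝ A x u v) := by
  have h1 := hR.hasFDerivAt.clm_apply (hA.hasFDerivAt.clm_apply (hasFDerivAt_const v x))
  have h2 : (fun z ↦ R z (A z v)) =ᶠ[nhds x] fun _ ↦ v := by
    filter_upwards [hRA] with z hz
    exact congrArg (fun L ↦ L v) hz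
  have h3 := h1.unique ((hasFDerivAt_const v x).congr_of_eventuallyEq h2)
  have h4 := congrArg (fun L ↦ L u) h3
  simp at h4
  exact eq_neg_of_add_eq_zero_right h4

theorem complProj_complProj (h : (R x).comp (A x) = ContinuousLinearMap.id ℝ V) (y : E) :
    complProj A R x (complProj A R x y) = complProj A R x y := by
  conv_lhs => rw [complProj_apply (R := R) y, map_sub, complProj_apply_of_leftInverse h, sub_zero]

/-- Constant `v`, `w` are coordinate fields, and `R (DA u v)` is the Christoffel term `∇_u v`. The
derivative of the projection contributes one correction, since the other part is tangential and is
killed by `complProj`; the two Christoffel terms supply the others. -/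
theorem complProj_fderiv_normalHess_const (hA : DifferentiableAt ℝ A x)
    (hA' : DifferentiableAt ℝ (fderiv ℝ A) x) (hR : DifferentiableAt ℝ R x)
    (h : (R x).comp (A x) = ContinuousLinearMap.id ℝ V)
    (hsymm : ∀ v w, fderiv ℝ A x v w = fderiv ℝ A x w v) (u v w : V) :
    complProj A R x (fderiv ℝ (fun z ↦ normalHess A R z v w) x u)
        - normalHess A R x (R x (fderiv ℝ A x u v)) w
        - normalHess A R x v (R x (fderiv ℝ A x u w)) = normalCubic A R x u v w := by
  rw [(hasFDerivAt_normalHess hA hA' hR (differentiableAt_const v) (differentiableAt_const w)).2]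
  simp only [fderiv_fun_const, Pi.zero_apply, zero_apply, map_zero, add_zero,
    map_sub, complProj_complProj h, complProj_apply_of_leftInverse h, sub_zero, normalHess,
    normalCubic]
  rw [hsymm (R x (fderiv ℝ A x u v)) w]
  abel

theorem complProj_fderiv_normalHess_leftInverse (hA : DifferentiableAt ℝ A x)
    (hA' : DifferentiableAt ℝ (fderiv ℝ A) x) (hR : DifferentiableAt ℝ R x)
    (h : ∀ᶠ z in nhds x, (R z).comp (A z) = ContinuousLinearMap.id ℝ V)
    (hsymm : ∀ v w, fderiv ℝ A x v w = fderiv ℝ A x w v) (u v w : V) :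
    complProj A R x (fderiv ℝ (fun z ↦ normalHess A R z (R z (A x v)) (R z (A x w))) x u) =
      normalCubic A R x u v w := by
  have hx := h.self_of_nhds
  have hx' : ∀ v, R x (A x v) = v := fun v ↦ congrArg (fun L ↦ L v) hx
  have hd : ∀ y : E, DifferentiableAt ℝ (fun z ↦ R z y) x := fun y ↦
    hR.clm_apply (differentiableAt_const y)
  have hd' : ∀ y : E, fderiv ℝ (fun z ↦ R z y) x u = fderiv ℝ R x u y := fun y ↦ by
    rw [(hR.hasFDerivAt.clm_apply (hasFDerivAt_const y x)).fderiv]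
    simp
  rw [(hasFDerivAt_normalHess hA hA' hR (hd _) (hd _)).2]
  simp only [hd', fderiv_leftInverse_apply hA hR h, hx']
  simp only [map_sub, map_add, complProj_complProj hx, complProj_apply_of_leftInverse hx, sub_zero,
    map_neg, normalCubic, neg_apply]
  rw [hsymm (R x (fderiv ℝ A x u v)) w]
  abel

/-- Both arguments of a bilinear expression vanish at `x`, so the product rule leaves nothing. -/
theorem fderiv_normalHess_of_apply_eq_zero (hA : DifferentiableAt ℝ A x)
    (hA' : DifferentiableAt ℝ (fderiv ℝ A) x) (hR : DifferentiableAt ℝ R x) {y z : E}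
    (hy : R x y = 0) (hz : R x z = 0) (u : V) :
    fderiv ℝ (fun t ↦ normalHess A R t (R t y) (R t z)) x u = 0 := by
  have hd : ∀ y : E, DifferentiableAt ℝ (fun z ↦ R z y) x := fun y ↦
    hR.clm_apply (differentiableAt_const y)
  rw [(hasFDerivAt_normalHess hA hA' hR (hd _) (hd _)).2]
  simp [hy, hz]

/-- Half of the Codazzi symmetry: second derivatives of `A` commute, and the three corrections are
permuted. -/
theorem normalCubic_swap_left (hA : ContDiffAt ℝ 2 A x)
    (hsymm : ∀ v w, fderiv ℝ A x v w = fderiv ℝ A x w v) (u v w : V) :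
    normalCubic A R x u v w = normalCubic A R x v u w := by
  have h : fderiv ℝ (fderiv ℝ A) x u v = fderiv ℝ (fderiv ℝ A) x v u :=
    (hA.isSymmSndFDerivAt (by simp)).eq u v
  rw [normalCubic, normalCubic, h, hsymm u v]
  congr 1
  abel

/-- The symmetry of `DA` is itself differentiated, hence is required near `x` and not only at `x`.
-/
theorem normalCubic_swap_right (hA' : DifferentiableAt ℝ (fderiv ℝ A) x)
    (hsymm : ∀ᶠ z in nhds x, ∀ v w, fderiv ℝ A z v w = fderiv ℝ A z w v) (u v w : V) :
    normalCubic A R x u v w = normalCubic A R x u w v := by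
  have h1 : ∀ v w, HasFDerivAt (fun z ↦ fderiv ℝ A z v w) _ x := fun v w ↦
    (hA'.hasFDerivAt.clm_apply (hasFDerivAt_const v x)).clm_apply (hasFDerivAt_const w x)
  have h2 : (fun z ↦ fderiv ℝ A z v w) =ᶠ[nhds x] fun z ↦ fderiv ℝ A z w v := by
    filter_upwards [hsymm] with z hz using hz v w
  have h3 := congrArg (fun L ↦ L u) ((h1 v w).unique ((h1 w v).congr_of_eventuallyEq h2))
  simp at h3
  rw [normalCubic, normalCubic, h3, hsymm.self_of_nhds v w]
  congr 1
  abel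

end Parametrized

/-! ### The metric left inverse of an injective linear map -/

section MetricLeftInverse

open scoped RealInnerProductSpace
open ContinuousLinearMap (adjoint)

variable {V E : Type*} [NormedAddCommGroup V] [InnerProductSpace ℝ V] [FiniteDimensional ℝ V]
  [CompleteSpace V] [NormedAddCommGroup E] [InnerProductSpace ℝ E]
  [CompleteSpace E]

/-- The left inverse `(A† A)⁻¹ A†` of an injective linear map. -/
noncomputable def metricLeftInverse (A : V →L[ℝ] E) : E →L[ℝ] V :=
  (Ring.inverse ((adjoint A).comp A)).comp (adjoint A)

theorem isUnit_adjoint_comp_self {A : V →L[ℝ] E} (hA : Function.Injective A) :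
    IsUnit ((adjoint A).comp A) := by
  have hinj : Function.Injective ((adjoint A).comp A) := by
    rw [injective_iff_map_eq_zero]
    intro v hv
    have h : ⟪(adjoint A) (A v), v⟫ = 0 := by
      rw [show (adjoint A) (A v) = 0 from hv, inner_zero_left]
    rw [ContinuousLinearMap.adjoint_inner_left, inner_self_eq_zero] at h
    exact (injective_iff_map_eq_zero A).mp hA v h
  exact ⟨ContinuousLinearEquiv.toUnit
    (LinearEquiv.ofInjectiveEndo ((adjoint A).comp A).toLinearMap hinj).toContinuousLinearEquiv,
    by ext v; rfl⟩

theorem metricLeftInverse_comp {A : V →L[ℝ] E} (hA : Function.Injective A) :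
    (metricLeftInverse A).comp A = ContinuousLinearMap.id ℝ V :=
  Ring.inverse_mul_cancel _ (isUnit_adjoint_comp_self hA)

theorem starProjection_range_eq {A : V →L[ℝ] E} (hA : Function.Injective A) (y : E) :
    (LinearMap.range A.toLinearMap).starProjection y = A (metricLeftInverse A y) := by
  refine Submodule.eq_starProjection_of_mem_of_inner_eq_zero
    (LinearMap.mem_range_self A.toLinearMap _) ?_
  rintro _ ⟨v, rfl⟩
  have h := ContinuousLinearMap.ext_iff.mp
    (Ring.mul_inverse_cancel _ (isUnit_adjoint_comp_self hA)) (adjoint A y)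
  have h' : adjoint A (A (metricLeftInverse A y)) = adjoint A y := h
  change ⟪y - A (metricLeftInverse A y), A v⟫ = 0
  rw [← ContinuousLinearMap.adjoint_inner_left, map_sub, h', sub_self, inner_zero_left]

theorem metricLeftInverse_eq_zero {A : V →L[ℝ] E} (hA : Function.Injective A) {y : E}
    (hy : y ∈ (LinearMap.range A.toLinearMap)ᗮ) : metricLeftInverse A y = 0 := by
  apply hA
  rw [← starProjection_range_eq hA, map_zero,
    Submodule.starProjection_apply_eq_zero_iff]
  exact hy

theorem differentiableAt_metricLeftInverse {A : V →L[ℝ] E} (hA : Function.Injective A) :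
    DifferentiableAt ℝ (metricLeftInverse (V := V) (E := E)) A := by
  have hadj : DifferentiableAt ℝ (fun A : V →L[ℝ] E ↦ adjoint A) A := by
    -- The adjoint is bundled as a conjugate-linear map; being additive and continuous, it is
    -- real-linear.
    let L : (V →L[ℝ] E) →+ (E →L[ℝ] V) :=
      (adjoint (𝕜 := ℝ) (E := V) (F := E)).toLinearEquiv.toAddEquiv.toAddMonoidHom
    exact (L.toRealLinearMap (adjoint (𝕜 := ℝ) (E := V) (F := E)).continuous).differentiableAt
  have hG : DifferentiableAt ℝ (fun A : V →L[ℝ] E ↦ (adjoint A).comp A) A :=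
    hadj.clm_comp differentiableAt_id
  obtain ⟨g, hg⟩ := isUnit_adjoint_comp_self hA
  have hinv : DifferentiableAt ℝ Ring.inverse ((adjoint A).comp A) := by
    rw [← hg]
    exact (contDiffAt_ringInverse ℝ (n := 1) g).differentiableAt (by simp)
  exact (hinv.comp (f := fun A : V →L[ℝ] E ↦ (adjoint A).comp A) A hG).clm_comp hadj

end MetricLeftInverse

/-! ### Traces in orthonormal bases adapted to a subspace -/

section AdaptedBasis

variable {ι κ E F : Type*} [Fintype ι] [Fintype κ] [NormedAddCommGroup E] [InnerProductSpace ℝ E]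
  [FiniteDimensional ℝ E]

/-- An orthonormal basis of a subspace, completed by one of its orthogonal complement. -/
noncomputable def OrthonormalBasis.adapted {U : Submodule ℝ E} (b : OrthonormalBasis ι ℝ U) :
    OrthonormalBasis (ι ⊕ Fin (Module.finrank ℝ Uᗮ)) ℝ E :=
  (b.prod (stdOrthonormalBasis ℝ Uᗮ)).map U.orthogonalDecomposition.symm

theorem OrthonormalBasis.adapted_inl {U : Submodule ℝ E} (b : OrthonormalBasis ι ℝ U) (i : ι) :
    b.adapted (Sum.inl i) = b i := by
  simp [OrthonormalBasis.adapted, Submodule.orthogonalDecomposition_symm_apply]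

theorem OrthonormalBasis.adapted_inr_mem {U : Submodule ℝ E} (b : OrthonormalBasis ι ℝ U)
    (j : Fin (Module.finrank ℝ Uᗮ)) : b.adapted (Sum.inr j) ∈ Uᗮ := by
  have : b.adapted (Sum.inr j) = stdOrthonormalBasis ℝ Uᗮ j := by
    simp [OrthonormalBasis.adapted, Submodule.orthogonalDecomposition_symm_apply]
  rw [this]
  exact Submodule.coe_mem _

/-- Lets a trace over a moving subspace be computed in an ambient basis that does not move. -/
theorem OrthonormalBasis.sum_bilin_eq_of_orthogonal [AddCommGroup F] [Module ℝ F]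
    {U : Submodule ℝ E} (b : OrthonormalBasis ι ℝ U) (ε : OrthonormalBasis κ ℝ E)
    (β : E →ₗ[ℝ] E →ₗ[ℝ] F) (hβ : ∀ c ∈ Uᗮ, β c c = 0) :
    ∑ a, β (ε a) (ε a) = ∑ i, β (b i) (b i) := by
  rw [ε.sum_bilin_eq b.adapted, Fintype.sum_sum_type]
  simp only [b.adapted_inl, hβ _ (b.adapted_inr_mem _), Finset.sum_const_zero, add_zero]

theorem OrthonormalBasis.sum_norm_sq_eq_of_orthogonal [NormedAddCommGroup F]
    [InnerProductSpace ℝ F] {U : Submodule ℝ E} (b : OrthonormalBasis ι ℝ U)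
    (ε : OrthonormalBasis κ ℝ E) (L : E →ₗ[ℝ] F) (hL : ∀ c ∈ Uᗮ, L c = 0) :
    ∑ a, ‖L (ε a)‖ ^ 2 = ∑ i, ‖L (b i)‖ ^ 2 := by
  have := b.sum_bilin_eq_of_orthogonal ε ((innerₗ F).compl₁₂ L L) (fun c hc ↦ by simp [hL c hc])
  simpa only [LinearMap.compl₁₂_apply, innerₗ_apply_apply, real_inner_self_eq_norm_sq] using this

end AdaptedBasis

/-! ### The geometry of an immersion in a chart -/

namespace ImmersedSubmanifold

variable {n m : ℕ} {M : Type*} [TopologicalSpace M] [ChartedSpace (EuclideanSpace ℝ (Fin n)) M]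

/-- The differential at `q` of the preferred chart at `p`. -/
noncomputable def chartDiff (p q : M) : TangentSpace (𝓡 n) q →L[ℝ] EuclideanSpace ℝ (Fin n) :=
  mvfderiv (𝓡 n) (extChartAt (𝓡 n) p) q

variable {p q : M}

theorem eventually_mem_chart_source (hq : q ∈ (chartAt (EuclideanSpace ℝ (Fin n)) p).source) :
    ∀ᶠ q' in nhds q, q' ∈ (chartAt (EuclideanSpace ℝ (Fin n)) p).source :=
  (chartAt (EuclideanSpace ℝ (Fin n)) p).open_source.mem_nhds hq

theorem extChartAt_symm_apply_self (hq : q ∈ (chartAt (EuclideanSpace ℝ (Fin n)) p).source) :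
    (extChartAt (𝓡 n) p).symm (extChartAt (𝓡 n) p q) = q :=
  (extChartAt (𝓡 n) p).left_inv (by rwa [extChartAt_source])

theorem eventuallyEq_comp_extChartAt (hq : q ∈ (chartAt (EuclideanSpace ℝ (Fin n)) p).source)
    {X : Type*} (g : M → X) : g =ᶠ[nhds q] (g ∘ (extChartAt (𝓡 n) p).symm) ∘ extChartAt (𝓡 n) p := by
  filter_upwards [eventually_mem_chart_source hq] with q' hq'
  simp only [Function.comp_apply, extChartAt_symm_apply_self hq']

theorem comp_extChartAt_symm_apply (hq : q ∈ (chartAt (EuclideanSpace ℝ (Fin n)) p).source)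
    {X : Type*} (g : M → X) :
    (g ∘ (extChartAt (𝓡 n) p).symm) (extChartAt (𝓡 n) p q) = g q :=
  congrArg g (extChartAt_symm_apply_self hq)

section

variable (S : ImmersedSubmanifold n m M)

theorem dF_tangentialPart (y : EuclideanSpace ℝ (Fin (m + n))) :
    S.dF q (S.tangentialPart q y) = (S.tangentPlane q).starProjection y := by
  have h : ((S.tangentEquiv q (S.tangentialPart q y) : S.tangentPlane q) :
      EuclideanSpace ℝ (Fin (m + n))) = S.dF q (S.tangentialPart q y) := rfl
  rw [← h, tangentialPart, LinearEquiv.apply_symm_apply]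
  rfl

/-- The orthonormal basis of the tangent plane which is the image of the frame. -/
noncomputable def planeBasis (q : M) : OrthonormalBasis (Fin n) ℝ (S.tangentPlane q) :=
  (stdOrthonormalBasis ℝ (S.tangentPlane q)).reindex (finCongr (S.finrank_tangentPlane q))

theorem dF_frame (i : Fin n) : S.dF q (S.frame q i) = S.planeBasis q i := by
  have h : ((S.tangentEquiv q (S.frame q i) : S.tangentPlane q) :
      EuclideanSpace ℝ (Fin (m + n))) = S.dF q (S.frame q i) := rfl
  rw [← h, frame, LinearEquiv.apply_symm_apply]
  rfl

end

variable [IsManifold (𝓡 n) ∞ M] {W : Type*} [NormedAddCommGroup W] [NormedSpace ℝ W]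

theorem mdifferentiableAt_and_mvfderiv_of_eventuallyEq {g : M → W}
    {h : EuclideanSpace ℝ (Fin n) → W}
    (hq : q ∈ (chartAt (EuclideanSpace ℝ (Fin n)) p).source)
    (hh : DifferentiableAt ℝ h (extChartAt (𝓡 n) p q))
    (hg : g =ᶠ[nhds q] h ∘ extChartAt (𝓡 n) p) :
    MDifferentiableAt (𝓡 n) 𝓘(ℝ, W) g q ∧ ∀ u,
      mvfderiv (𝓡 n) g q u = fderiv ℝ h (extChartAt (𝓡 n) p q) (chartDiff p q u) := by
  have h1 : MDifferentiableAt (𝓡 n) 𝓘(ℝ, EuclideanSpace ℝ (Fin n)) (extChartAt (𝓡 n) p) q :=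
    mdifferentiableAt_extChartAt hq
  have h2 : MDifferentiableAt 𝓘(ℝ, EuclideanSpace ℝ (Fin n)) 𝓘(ℝ, W) h (extChartAt (𝓡 n) p q) :=
    hh.mdifferentiableAt
  refine ⟨(h2.comp q h1).congr_of_eventuallyEq hg, fun u ↦ ?_⟩
  have h3 : mvfderiv (𝓡 n) g q u = mfderiv (𝓡 n) 𝓘(ℝ, W) g q u := rfl
  have h4 := ((h2.hasMFDerivAt.comp q h1.hasMFDerivAt).congr_of_eventuallyEq hg).mfderiv
  rw [mfderiv_eq_fderiv] at h4
  exact h3.trans (congrArg (fun L ↦ L u) h4)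

theorem contMDiffAt_extChartAt_symm (hq : q ∈ (chartAt (EuclideanSpace ℝ (Fin n)) p).source) :
    ContMDiffAt 𝓘(ℝ, EuclideanSpace ℝ (Fin n)) (𝓡 n) ∞ (extChartAt (𝓡 n) p).symm
      (extChartAt (𝓡 n) p q) :=
  (contMDiffOn_extChartAt_symm p).contMDiffAt ((isOpen_extChartAt_target p).mem_nhds
    ((extChartAt (𝓡 n) p).map_source (by rwa [extChartAt_source])))

theorem differentiableAt_comp_extChartAt_symm
    (hq : q ∈ (chartAt (EuclideanSpace ℝ (Fin n)) p).source) {g : M → W}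
    (hg : MDifferentiableAt (𝓡 n) 𝓘(ℝ, W) g q) :
    DifferentiableAt ℝ (g ∘ (extChartAt (𝓡 n) p).symm) (extChartAt (𝓡 n) p q) := by
  rw [← mdifferentiableAt_iff_differentiableAt]
  refine MDifferentiableAt.comp (I' := 𝓡 n) _ ?_
    ((contMDiffAt_extChartAt_symm hq).mdifferentiableAt (by simp))
  rwa [extChartAt_symm_apply_self hq]

theorem chartDiff_eq (hq : q ∈ (chartAt (EuclideanSpace ℝ (Fin n)) p).source)
    (u : TangentSpace (𝓡 n) q) :
    chartDiff p q u =
      (trivializationAt (EuclideanSpace ℝ (Fin n)) (TangentSpace (𝓡 n)) p ⟨q, u⟩).2 := by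
  have h := TangentBundle.continuousLinearMapAt_trivializationAt (I := 𝓡 n) hq
  have h1 : chartDiff p q u = (trivializationAt (EuclideanSpace ℝ (Fin n))
      (TangentSpace (𝓡 n)) p).continuousLinearMapAt ℝ q u := by
    rw [h]
    rfl
  rw [h1, Bundle.Trivialization.continuousLinearMapAt_apply,
    Bundle.Trivialization.coe_linearMapAt_of_mem]
  rwa [TangentBundle.trivializationAt_baseSet]

theorem chartDiff_bijective (hq : q ∈ (chartAt (EuclideanSpace ℝ (Fin n)) p).source) :
    Function.Bijective (chartDiff (n := n) p q) := by
  obtain ⟨L, hL⟩ := isInvertible_mfderiv_extChartAt (I := 𝓡 n) (x := p) (y := q)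
    (by rwa [extChartAt_source])
  have : ⇑(chartDiff (n := n) p q) = L := by
    funext u
    exact (congrArg (fun T ↦ T u) hL).symm
  rw [this]
  exact L.bijective

theorem chartDiff_extendVector_self (w : TangentSpace (𝓡 n) p)
    (hq : q ∈ (chartAt (EuclideanSpace ℝ (Fin n)) p).source) :
    chartDiff p q (extendVector w q) = chartDiff p p w := by
  rw [chartDiff_eq hq, chartDiff_eq (mem_chart_source _ p), extendVector, FiberBundle.extend,
    Bundle.Trivialization.apply_mk_symm]
  rwa [TangentBundle.trivializationAt_baseSet]

/-- The extension of a vector at `q` is built from the preferred chart at `q`; in the chart at `p`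
it need not be constant, and differentiability is all that is needed. -/
theorem mdifferentiableAt_chartDiff_extendVector (w : TangentSpace (𝓡 n) q)
    (hq : q ∈ (chartAt (EuclideanSpace ℝ (Fin n)) p).source) :
    MDifferentiableAt (𝓡 n) 𝓘(ℝ, EuclideanSpace ℝ (Fin n))
      (fun q' ↦ chartDiff p q' (extendVector w q')) q := by
  have h := FiberBundle.mdifferentiableAt_extend (𝓡 n) (EuclideanSpace ℝ (Fin n)) w
  rw [Bundle.Trivialization.mdifferentiableAt_section_iff (𝓡 n)
    (trivializationAt (EuclideanSpace ℝ (Fin n)) (TangentSpace (𝓡 n)) p) _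
    (by rwa [TangentBundle.trivializationAt_baseSet])] at h
  refine h.congr_of_eventuallyEq ?_
  filter_upwards [eventually_mem_chart_source hq] with q' hq'
  exact chartDiff_eq hq' _

theorem extendVector_self (w : TangentSpace (𝓡 n) p) : extendVector w p = w :=
  FiberBundle.extend_apply_self _ w

/-! ### The immersion and its second fundamental form in a chart. -/

variable (S : ImmersedSubmanifold n m M)

/-- The derivative of the immersion, read in the preferred chart at `p`. -/
noncomputable def localDeriv (p : M) : EuclideanSpace ℝ (Fin n) →
    EuclideanSpace ℝ (Fin n) →L[ℝ] EuclideanSpace ℝ (Fin (m + n)) :=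
  fderiv ℝ (S.toFun ∘ (extChartAt (𝓡 n) p).symm)

/-- The metric left inverse of the derivative of the immersion, read in the preferred chart. -/
noncomputable def localInverse (p : M) : EuclideanSpace ℝ (Fin n) →
    EuclideanSpace ℝ (Fin (m + n)) →L[ℝ] EuclideanSpace ℝ (Fin n) :=
  fun x ↦ metricLeftInverse (S.localDeriv p x)

theorem contDiffAt_local (hq : q ∈ (chartAt (EuclideanSpace ℝ (Fin n)) p).source) :
    ContDiffAt ℝ ∞ (S.toFun ∘ (extChartAt (𝓡 n) p).symm) (extChartAt (𝓡 n) p q) :=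
  (S.contMDiff.contMDiffAt.comp _ (contMDiffAt_extChartAt_symm hq)).contDiffAt

theorem contDiffAt_localDeriv (hq : q ∈ (chartAt (EuclideanSpace ℝ (Fin n)) p).source) :
    ContDiffAt ℝ 2 (S.localDeriv p) (extChartAt (𝓡 n) p q) :=
  (S.contDiffAt_local hq).fderiv_right (by
    norm_cast)

theorem differentiableAt_localDeriv (hq : q ∈ (chartAt (EuclideanSpace ℝ (Fin n)) p).source) :
    DifferentiableAt ℝ (S.localDeriv p) (extChartAt (𝓡 n) p q) :=
  (S.contDiffAt_localDeriv hq).differentiableAt (by simp)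

theorem differentiableAt_fderiv_localDeriv
    (hq : q ∈ (chartAt (EuclideanSpace ℝ (Fin n)) p).source) :
    DifferentiableAt ℝ (fderiv ℝ (S.localDeriv p)) (extChartAt (𝓡 n) p q) :=
  ((S.contDiffAt_localDeriv hq).fderiv_right (m := 1) (by norm_num)).differentiableAt (by simp)

theorem fderiv_localDeriv_symm (hq : q ∈ (chartAt (EuclideanSpace ℝ (Fin n)) p).source)
    (v w : EuclideanSpace ℝ (Fin n)) :
    fderiv ℝ (S.localDeriv p) (extChartAt (𝓡 n) p q) v w =
      fderiv ℝ (S.localDeriv p) (extChartAt (𝓡 n) p q) w v :=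
  ((S.contDiffAt_local hq).isSymmSndFDerivAt (by
    simpa using (by norm_cast : (2 : WithTop ℕ∞) ≤ ∞))).eq v w

theorem dF_eq (hq : q ∈ (chartAt (EuclideanSpace ℝ (Fin n)) p).source)
    (u : TangentSpace (𝓡 n) q) :
    S.dF q u = S.localDeriv p (extChartAt (𝓡 n) p q) (chartDiff p q u) :=
  (mdifferentiableAt_and_mvfderiv_of_eventuallyEq hq
    ((S.contDiffAt_local hq).differentiableAt (by simp))
    (eventuallyEq_comp_extChartAt hq S.toFun)).2 u

theorem injective_localDeriv (hq : q ∈ (chartAt (EuclideanSpace ℝ (Fin n)) p).source) :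
    Function.Injective (S.localDeriv p (extChartAt (𝓡 n) p q)) := by
  intro v w h
  obtain ⟨v, rfl⟩ := (chartDiff_bijective hq).2 v
  obtain ⟨w, rfl⟩ := (chartDiff_bijective hq).2 w
  rw [← S.dF_eq hq, ← S.dF_eq hq] at h
  rw [S.injective_deriv q h]

theorem tangentPlane_eq (hq : q ∈ (chartAt (EuclideanSpace ℝ (Fin n)) p).source) :
    S.tangentPlane q =
      LinearMap.range (S.localDeriv p (extChartAt (𝓡 n) p q)).toLinearMap := by
  ext y
  constructor
  · rintro ⟨u, rfl⟩
    exact ⟨chartDiff p q u, (S.dF_eq hq u).symm⟩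
  · rintro ⟨v, rfl⟩
    obtain ⟨v, rfl⟩ := (chartDiff_bijective hq).2 v
    exact ⟨v, S.dF_eq hq v⟩

theorem localInverse_comp (hq : q ∈ (chartAt (EuclideanSpace ℝ (Fin n)) p).source) :
    (S.localInverse p (extChartAt (𝓡 n) p q)).comp (S.localDeriv p (extChartAt (𝓡 n) p q)) =
      ContinuousLinearMap.id ℝ _ :=
  metricLeftInverse_comp (S.injective_localDeriv hq)

theorem differentiableAt_localInverse (hq : q ∈ (chartAt (EuclideanSpace ℝ (Fin n)) p).source) :
    DifferentiableAt ℝ (S.localInverse p) (extChartAt (𝓡 n) p q) :=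
  (differentiableAt_metricLeftInverse (S.injective_localDeriv hq)).comp _
    (S.differentiableAt_localDeriv hq)

theorem starProjection_tangentPlane (hq : q ∈ (chartAt (EuclideanSpace ℝ (Fin n)) p).source)
    (y : EuclideanSpace ℝ (Fin (m + n))) :
    (S.tangentPlane q).starProjection y = S.localDeriv p (extChartAt (𝓡 n) p q)
      (S.localInverse p (extChartAt (𝓡 n) p q) y) := by
  rw [localInverse, ← starProjection_range_eq (S.injective_localDeriv hq)]
  simp only [S.tangentPlane_eq hq]

theorem normalPart_eq (hq : q ∈ (chartAt (EuclideanSpace ℝ (Fin n)) p).source)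
    (y : EuclideanSpace ℝ (Fin (m + n))) :
    S.normalPart q y =
      complProj (S.localDeriv p) (S.localInverse p) (extChartAt (𝓡 n) p q) y := by
  rw [normalPart, Submodule.starProjection_orthogonal_val, S.starProjection_tangentPlane hq,
    complProj_apply]

theorem chartDiff_tangentialPart (hq : q ∈ (chartAt (EuclideanSpace ℝ (Fin n)) p).source)
    (y : EuclideanSpace ℝ (Fin (m + n))) :
    chartDiff p q (S.tangentialPart q y) = S.localInverse p (extChartAt (𝓡 n) p q) y := by
  apply S.injective_localDeriv hq
  rw [← S.dF_eq hq, S.dF_tangentialPart, S.starProjection_tangentPlane hq]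

theorem localDeriv_chartDiff_frame (hq : q ∈ (chartAt (EuclideanSpace ℝ (Fin n)) p).source)
    (i : Fin n) : S.localDeriv p (extChartAt (𝓡 n) p q) (chartDiff p q (S.frame q i)) =
      S.planeBasis q i := by
  rw [← S.dF_eq hq, S.dF_frame]

theorem localInverse_planeBasis (hq : q ∈ (chartAt (EuclideanSpace ℝ (Fin n)) p).source)
    (i : Fin n) : S.localInverse p (extChartAt (𝓡 n) p q) (S.planeBasis q i) =
      chartDiff p q (S.frame q i) := by
  rw [← S.localDeriv_chartDiff_frame hq]
  exact congrArg (fun L ↦ L (chartDiff p q (S.frame q i))) (S.localInverse_comp hq)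

theorem localInverse_eq_zero (hq : q ∈ (chartAt (EuclideanSpace ℝ (Fin n)) p).source)
    {y : EuclideanSpace ℝ (Fin (m + n))} (hy : y ∈ (S.tangentPlane q)ᗮ) :
    S.localInverse p (extChartAt (𝓡 n) p q) y = 0 := by
  rw [S.tangentPlane_eq hq] at hy
  exact metricLeftInverse_eq_zero (S.injective_localDeriv hq) hy

/-- The product rule for `A Y`. The derivative of `Y` enters only through a tangential term, so the
normal part depends on the value of `Y` alone. -/
theorem ambientDeriv_eq (hq : q ∈ (chartAt (EuclideanSpace ℝ (Fin n)) p).source)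
    {Y : (q : M) → TangentSpace (𝓡 n) q}
    (hY : MDifferentiableAt (𝓡 n) 𝓘(ℝ, EuclideanSpace ℝ (Fin n))
      (fun q' ↦ chartDiff p q' (Y q')) q) (u : TangentSpace (𝓡 n) q) :
    S.ambientDeriv Y q u =
      fderiv ℝ (S.localDeriv p) (extChartAt (𝓡 n) p q) (chartDiff p q u) (chartDiff p q (Y q)) +
      S.localDeriv p (extChartAt (𝓡 n) p q)
        (mvfderiv (𝓡 n) (fun q' ↦ chartDiff p q' (Y q')) q u) := by
  have h1 := differentiableAt_comp_extChartAt_symm hq hY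
  have h2 := (S.differentiableAt_localDeriv hq).hasFDerivAt.clm_apply h1.hasFDerivAt
  rw [ambientDeriv, (mdifferentiableAt_and_mvfderiv_of_eventuallyEq hq h2.differentiableAt
    (g := fun q' ↦ S.dF q' (Y q')) (by
      filter_upwards [eventually_mem_chart_source hq] with q' hq'
      rw [Function.comp_apply, comp_extChartAt_symm_apply hq', S.dF_eq hq'])).2, h2.fderiv,
    (mdifferentiableAt_and_mvfderiv_of_eventuallyEq hq h1
      (eventuallyEq_comp_extChartAt hq _)).2]
  rw [comp_extChartAt_symm_apply hq]
  exact add_comm _ _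

theorem secondFundamentalForm_eq (hq : q ∈ (chartAt (EuclideanSpace ℝ (Fin n)) p).source)
    (u w : TangentSpace (𝓡 n) q) :
    S.secondFundamentalForm q u w = normalHess (S.localDeriv p) (S.localInverse p)
      (extChartAt (𝓡 n) p q) (chartDiff p q u) (chartDiff p q w) := by
  rw [secondFundamentalForm, S.normalPart_eq hq,
    S.ambientDeriv_eq hq (mdifferentiableAt_chartDiff_extendVector w hq), map_add,
    complProj_apply_of_leftInverse (S.localInverse_comp hq), add_zero, extendVector_self]
  rfl

theorem ambientDeriv_extendVector (u w : TangentSpace (𝓡 n) p) :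
    S.ambientDeriv (extendVector w) p u = fderiv ℝ (S.localDeriv p) (extChartAt (𝓡 n) p p)
      (chartDiff p p u) (chartDiff p p w) := by
  have hp := mem_chart_source (EuclideanSpace ℝ (Fin n)) p
  rw [S.ambientDeriv_eq hp (mdifferentiableAt_chartDiff_extendVector w hp), extendVector_self,
    (mdifferentiableAt_and_mvfderiv_of_eventuallyEq hp (h := fun _ ↦ chartDiff p p w)
      (differentiableAt_const _) (g := fun q' ↦ chartDiff p q' (extendVector w q')) (by
        filter_upwards [eventually_mem_chart_source hp] with q' hq'
        exact chartDiff_extendVector_self w hq')).2]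
  simp

theorem eventually_localInverse_comp (p : M) : ∀ᶠ z in nhds (extChartAt (𝓡 n) p p),
    (S.localInverse p z).comp (S.localDeriv p z) = ContinuousLinearMap.id ℝ _ := by
  filter_upwards [extChartAt_target_mem_nhds (I := 𝓡 n) p] with z hz
  rw [← (extChartAt (𝓡 n) p).right_inv hz]
  exact S.localInverse_comp (by
    rw [← extChartAt_source (𝓡 n)]
    exact (extChartAt (𝓡 n) p).map_target hz)

theorem eventually_fderiv_localDeriv_symm (p : M) : ∀ᶠ z in nhds (extChartAt (𝓡 n) p p),
    ∀ v w, fderiv ℝ (S.localDeriv p) z v w = fderiv ℝ (S.localDeriv p) z w v := by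
  filter_upwards [extChartAt_target_mem_nhds (I := 𝓡 n) p] with z hz
  rw [← (extChartAt (𝓡 n) p).right_inv hz]
  exact S.fderiv_localDeriv_symm (by
    rw [← extChartAt_source (𝓡 n)]
    exact (extChartAt (𝓡 n) p).map_target hz)

theorem nablaB_eq (u v w : TangentSpace (𝓡 n) p) :
    S.nablaB p u v w = normalCubic (S.localDeriv p) (S.localInverse p) (extChartAt (𝓡 n) p p)
      (chartDiff p p u) (chartDiff p p v) (chartDiff p p w) := by
  have hp := mem_chart_source (EuclideanSpace ℝ (Fin n)) p
  have hd := hasFDerivAt_normalHess (S.differentiableAt_localDeriv hp)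
    (S.differentiableAt_fderiv_localDeriv hp) (S.differentiableAt_localInverse hp)
    (differentiableAt_const (chartDiff p p v)) (differentiableAt_const (chartDiff p p w))
  rw [nablaB, normalConnection, S.normalPart_eq hp, S.secondFundamentalForm_eq hp,
    S.secondFundamentalForm_eq hp, tangentConnection, tangentConnection,
    S.chartDiff_tangentialPart hp, S.chartDiff_tangentialPart hp,
    S.ambientDeriv_extendVector, S.ambientDeriv_extendVector,
    ← complProj_fderiv_normalHess_const (S.differentiableAt_localDeriv hp)
      (S.differentiableAt_fderiv_localDeriv hp) (S.differentiableAt_localInverse hp)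
      (S.localInverse_comp hp) (S.fderiv_localDeriv_symm hp),
    (mdifferentiableAt_and_mvfderiv_of_eventuallyEq hp hd.1 (g := fun q ↦
      S.secondFundamentalForm q (extendVector v q) (extendVector w q)) (by
        filter_upwards [eventually_mem_chart_source hp] with q' hq'
        rw [S.secondFundamentalForm_eq hq', chartDiff_extendVector_self v hq',
          chartDiff_extendVector_self w hq']
        rfl)).2]

theorem nablaB_swap_left (u v w : TangentSpace (𝓡 n) p) :
    S.nablaB p u v w = S.nablaB p v u w := by
  have hp := mem_chart_source (EuclideanSpace ℝ (Fin n)) p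
  rw [nablaB_eq, nablaB_eq, normalCubic_swap_left (S.contDiffAt_localDeriv hp)
    (S.fderiv_localDeriv_symm hp)]

theorem nablaB_swap_right (u v w : TangentSpace (𝓡 n) p) :
    S.nablaB p u v w = S.nablaB p u w v := by
  have hp := mem_chart_source (EuclideanSpace ℝ (Fin n)) p
  rw [nablaB_eq, nablaB_eq, normalCubic_swap_right (S.differentiableAt_fderiv_localDeriv hp)
    (S.eventually_fderiv_localDeriv_symm p)]

end ImmersedSubmanifold

/-! ### Derivatives of the mean curvature and of the norm of the second fundamental form -/

namespace ImmersedSubmanifold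

open scoped RealInnerProductSpace

variable {n m : ℕ} {M : Type*} [TopologicalSpace M] [ChartedSpace (EuclideanSpace ℝ (Fin n)) M]
  (S : ImmersedSubmanifold n m M) {p q : M} {κ : Type*} [Fintype κ]

theorem inner_normalPart_right {y z : EuclideanSpace ℝ (Fin (m + n))}
    (hy : S.normalPart p y = y) : ⟪y, S.normalPart p z⟫ = ⟪y, z⟫ := by
  conv_rhs => rw [← hy]
  exact ((S.tangentPlane p)ᗮ.inner_starProjection_left_eq_right y z).symm

/-- The second fundamental form read in the preferred chart at `p`, extended to the ambient space
by zero on the normal space. -/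
noncomputable def ambientForm (p : M) (x : EuclideanSpace ℝ (Fin n)) :
    EuclideanSpace ℝ (Fin (m + n)) →ₗ[ℝ] EuclideanSpace ℝ (Fin (m + n)) →ₗ[ℝ]
      EuclideanSpace ℝ (Fin (m + n)) :=
  LinearMap.mk₂ ℝ (fun y z ↦ normalHess (S.localDeriv p) (S.localInverse p) x
    (S.localInverse p x y) (S.localInverse p x z))
    (by simp [normalHess]) (by simp [normalHess]) (by simp [normalHess]) (by simp [normalHess])

theorem ambientForm_apply (x : EuclideanSpace ℝ (Fin n))
    (y z : EuclideanSpace ℝ (Fin (m + n))) :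
    S.ambientForm p x y z = normalHess (S.localDeriv p) (S.localInverse p) x
      (S.localInverse p x y) (S.localInverse p x z) := rfl

variable [IsManifold (𝓡 n) ∞ M]

theorem ambientForm_planeBasis (hq : q ∈ (chartAt (EuclideanSpace ℝ (Fin n)) p).source)
    (i j : Fin n) :
    S.ambientForm p (extChartAt (𝓡 n) p q) (S.planeBasis q i) (S.planeBasis q j) =
      S.secondFundamentalForm q (S.frame q i) (S.frame q j) := by
  rw [S.secondFundamentalForm_eq hq, ambientForm_apply, S.localInverse_planeBasis hq,
    S.localInverse_planeBasis hq]

theorem ambientForm_left_eq_zero (hq : q ∈ (chartAt (EuclideanSpace ℝ (Fin n)) p).source)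
    {y : EuclideanSpace ℝ (Fin (m + n))} (hy : y ∈ (S.tangentPlane q)ᗮ)
    (z : EuclideanSpace ℝ (Fin (m + n))) :
    S.ambientForm p (extChartAt (𝓡 n) p q) y z = 0 := by
  rw [ambientForm_apply, S.localInverse_eq_zero hq hy]
  simp [normalHess]

theorem ambientForm_right_eq_zero (hq : q ∈ (chartAt (EuclideanSpace ℝ (Fin n)) p).source)
    (y : EuclideanSpace ℝ (Fin (m + n)))
    {z : EuclideanSpace ℝ (Fin (m + n))} (hz : z ∈ (S.tangentPlane q)ᗮ) :
    S.ambientForm p (extChartAt (𝓡 n) p q) y z = 0 := by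
  rw [ambientForm_apply, S.localInverse_eq_zero hq hz]
  simp [normalHess]

/-- The basis `ε` is independent of `q`, unlike the frame, so the right-hand side can be
differentiated in `q`. -/
theorem meanCurvature_eq (hq : q ∈ (chartAt (EuclideanSpace ℝ (Fin n)) p).source)
    (ε : OrthonormalBasis κ ℝ (EuclideanSpace ℝ (Fin (m + n)))) :
    S.meanCurvature q = ∑ a, S.ambientForm p (extChartAt (𝓡 n) p q) (ε a) (ε a) := by
  rw [(S.planeBasis q).sum_bilin_eq_of_orthogonal ε _
    (fun c hc ↦ S.ambientForm_left_eq_zero hq hc c), meanCurvature]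
  simp only [S.ambientForm_planeBasis hq]

theorem sum_norm_sq_secondFundamentalForm_eq
    (hq : q ∈ (chartAt (EuclideanSpace ℝ (Fin n)) p).source)
    (ε : OrthonormalBasis κ ℝ (EuclideanSpace ℝ (Fin (m + n)))) :
    ∑ i, ∑ j, ‖S.secondFundamentalForm q (S.frame q i) (S.frame q j)‖ ^ 2 =
      ∑ a, ∑ b, ‖S.ambientForm p (extChartAt (𝓡 n) p q) (ε a) (ε b)‖ ^ 2 := by
  have h1 : ∀ y, ∑ b, ‖S.ambientForm p (extChartAt (𝓡 n) p q) y (ε b)‖ ^ 2 =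
      ∑ j, ‖S.ambientForm p (extChartAt (𝓡 n) p q) y (S.planeBasis q j)‖ ^ 2 := fun y ↦
    (S.planeBasis q).sum_norm_sq_eq_of_orthogonal ε (S.ambientForm p (extChartAt (𝓡 n) p q) y)
      (fun c hc ↦ S.ambientForm_right_eq_zero hq y hc)
  have h2 : ∀ z, ∑ a, ‖S.ambientForm p (extChartAt (𝓡 n) p q) (ε a) z‖ ^ 2 =
      ∑ i, ‖S.ambientForm p (extChartAt (𝓡 n) p q) (S.planeBasis q i) z‖ ^ 2 := fun z ↦
    (S.planeBasis q).sum_norm_sq_eq_of_orthogonal ε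
      ((S.ambientForm p (extChartAt (𝓡 n) p q)).flip z)
      (fun c hc ↦ S.ambientForm_left_eq_zero hq hc z)
  symm
  rw [Finset.sum_congr rfl fun a _ ↦ h1 (ε a), Finset.sum_comm,
    Finset.sum_congr rfl fun j _ ↦ h2 (S.planeBasis q j), Finset.sum_comm]
  simp only [S.ambientForm_planeBasis hq]

theorem differentiableAt_ambientForm (p : M) (y z : EuclideanSpace ℝ (Fin (m + n))) :
    DifferentiableAt ℝ (fun x ↦ S.ambientForm p x y z) (extChartAt (𝓡 n) p p) := by
  have hp := mem_chart_source (EuclideanSpace ℝ (Fin n)) p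
  have hR := S.differentiableAt_localInverse hp
  exact (hasFDerivAt_normalHess (S.differentiableAt_localDeriv hp)
    (S.differentiableAt_fderiv_localDeriv hp) hR
    (hR.clm_apply (differentiableAt_const y)) (hR.clm_apply (differentiableAt_const z))).1

theorem normalPart_fderiv_ambientForm (u : TangentSpace (𝓡 n) p) (i j : Fin n) :
    S.normalPart p (fderiv ℝ (fun x ↦ S.ambientForm p x (S.planeBasis p i) (S.planeBasis p j))
      (extChartAt (𝓡 n) p p) (chartDiff p p u)) =
      S.nablaB p u (S.frame p i) (S.frame p j) := by
  have hp := mem_chart_source (EuclideanSpace ℝ (Fin n)) p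
  rw [S.normalPart_eq hp, S.nablaB_eq, ← complProj_fderiv_normalHess_leftInverse
    (S.differentiableAt_localDeriv hp) (S.differentiableAt_fderiv_localDeriv hp)
    (S.differentiableAt_localInverse hp) (S.eventually_localInverse_comp p)
    (S.fderiv_localDeriv_symm hp), S.localDeriv_chartDiff_frame hp, S.localDeriv_chartDiff_frame hp]
  rfl

theorem fderiv_ambientForm_eq_zero {y z : EuclideanSpace ℝ (Fin (m + n))}
    (hy : y ∈ (S.tangentPlane p)ᗮ) (hz : z ∈ (S.tangentPlane p)ᗮ) (v : EuclideanSpace ℝ (Fin n)) :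
    fderiv ℝ (fun x ↦ S.ambientForm p x y z) (extChartAt (𝓡 n) p p) v = 0 := by
  have hp := mem_chart_source (EuclideanSpace ℝ (Fin n)) p
  exact fderiv_normalHess_of_apply_eq_zero (S.differentiableAt_localDeriv hp)
    (S.differentiableAt_fderiv_localDeriv hp) (S.differentiableAt_localInverse hp)
    (S.localInverse_eq_zero hp hy) (S.localInverse_eq_zero hp hz) v

/-- The covariant derivative of the mean curvature is the trace of that of the second fundamental
form. -/
theorem normalConnection_meanCurvature (u : TangentSpace (𝓡 n) p) :
    S.normalConnection S.meanCurvature p u =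
      ∑ i, S.nablaB p u (S.frame p i) (S.frame p i) := by
  have hp := mem_chart_source (EuclideanSpace ℝ (Fin n)) p
  set ε := (S.planeBasis p).adapted
  have hd : ∀ a ∈ Finset.univ, DifferentiableAt ℝ (fun x ↦ S.ambientForm p x (ε a) (ε a))
      (extChartAt (𝓡 n) p p) := fun a _ ↦ S.differentiableAt_ambientForm p _ _
  rw [normalConnection, (mdifferentiableAt_and_mvfderiv_of_eventuallyEq hp
    (DifferentiableAt.fun_sum hd) (g := S.meanCurvature) (by
      filter_upwards [eventually_mem_chart_source hp] with q' hq'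
      exact S.meanCurvature_eq hq' ε)).2, fderiv_fun_sum hd, sum_apply,
    Fintype.sum_sum_type]
  -- The basis is adapted to the tangent plane at `p`: its tangential vectors are the image of the
  -- frame, and its normal vectors contribute terms with zero derivative.
  simp only [ε, OrthonormalBasis.adapted_inl,
    S.fderiv_ambientForm_eq_zero ((S.planeBasis p).adapted_inr_mem _)
      ((S.planeBasis p).adapted_inr_mem _), Finset.sum_const_zero, add_zero]
  rw [normalPart, map_sum]
  exact Finset.sum_congr rfl fun i _ ↦ S.normalPart_fderiv_ambientForm u i i

theorem normalPart_secondFundamentalForm (u w : TangentSpace (𝓡 n) p) :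
    S.normalPart p (S.secondFundamentalForm p u w) = S.secondFundamentalForm p u w := by
  have hp := mem_chart_source (EuclideanSpace ℝ (Fin n)) p
  rw [S.secondFundamentalForm_eq hp, S.normalPart_eq hp, normalHess,
    complProj_complProj (S.localInverse_comp hp)]

/-- The squared norm of the second fundamental form is differentiable, with the expected
derivative. -/
theorem mvfderiv_sum_norm_sq (p : M) :
    MDifferentiableAt (𝓡 n) 𝓘(ℝ, ℝ) (fun q ↦ ∑ i, ∑ j,
      ‖S.secondFundamentalForm q (S.frame q i) (S.frame q j)‖ ^ 2) p ∧
    ∀ u, mvfderiv (𝓡 n) (fun q ↦ ∑ i, ∑ j,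
      ‖S.secondFundamentalForm q (S.frame q i) (S.frame q j)‖ ^ 2) p u =
        2 * ∑ i, ∑ j, ⟪S.secondFundamentalForm p (S.frame p i) (S.frame p j),
          S.nablaB p u (S.frame p i) (S.frame p j)⟫ := by
  have hp := mem_chart_source (EuclideanSpace ℝ (Fin n)) p
  set ε := (S.planeBasis p).adapted
  have hd := HasFDerivAt.fun_sum (u := Finset.univ) fun a _ ↦
    HasFDerivAt.fun_sum (u := Finset.univ) fun b _ ↦
      (S.differentiableAt_ambientForm p (ε a) (ε b)).hasFDerivAt.norm_sq
  have key := mdifferentiableAt_and_mvfderiv_of_eventuallyEq hp hd.differentiableAt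
    (g := fun q ↦ ∑ i, ∑ j, ‖S.secondFundamentalForm q (S.frame q i) (S.frame q j)‖ ^ 2) (by
      filter_upwards [eventually_mem_chart_source hp] with q' hq'
      exact S.sum_norm_sq_secondFundamentalForm_eq hq' ε)
  refine ⟨key.1, fun u ↦ ?_⟩
  rw [key.2, hd.fderiv]
  simp only [sum_apply, smul_apply, ContinuousLinearMap.comp_apply, innerSL_apply_apply]
  -- Terms with a normal basis vector drop out because the undifferentiated factor vanishes at `p`.
  -- In the others that factor is normal, so only the normal part of the derivative counts.
  simp only [Fintype.sum_sum_type, ε, OrthonormalBasis.adapted_inl,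
    S.ambientForm_left_eq_zero hp ((S.planeBasis p).adapted_inr_mem _),
    S.ambientForm_right_eq_zero hp _ ((S.planeBasis p).adapted_inr_mem _), inner_zero_left,
    smul_zero, Finset.sum_const_zero, add_zero, Finset.mul_sum]
  refine Finset.sum_congr rfl fun i _ ↦ Finset.sum_congr rfl fun j _ ↦ ?_
  rw [S.ambientForm_planeBasis hp, ← S.normalPart_fderiv_ambientForm u i j,
    S.inner_normalPart_right (S.normalPart_secondFundamentalForm _ _)]
  simp

/-! ### The differential of `|B|` and the refined Kato inequality. -/

theorem normB_sq (q : M) :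
    S.normB q ^ 2 = ∑ i, ∑ j, ‖S.secondFundamentalForm q (S.frame q i) (S.frame q j)‖ ^ 2 :=
  Real.sq_sqrt (Finset.sum_nonneg fun _ _ ↦ Finset.sum_nonneg fun _ _ ↦ sq_nonneg _)

theorem mdifferentiableAt_normB (h : S.normB p ≠ 0) :
    MDifferentiableAt (𝓡 n) 𝓘(ℝ, ℝ) S.normB p := by
  have h1 : MDifferentiableAt 𝓘(ℝ, ℝ) 𝓘(ℝ, ℝ) Real.sqrt
      (∑ i, ∑ j, ‖S.secondFundamentalForm p (S.frame p i) (S.frame p j)‖ ^ 2) := by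
    refine (DifferentiableAt.sqrt differentiableAt_id ?_).mdifferentiableAt
    rw [id, ← S.normB_sq]
    exact pow_ne_zero 2 h
  exact MDifferentiableAt.comp (I' := 𝓘(ℝ, ℝ)) p h1 (S.mvfderiv_sum_norm_sq p).1

/-- The product rule for `|B|² = |B| · |B|`. -/
theorem normB_mul_mvfderiv_normB (h : MDifferentiableAt (𝓡 n) 𝓘(ℝ, ℝ) S.normB p)
    (u : TangentSpace (𝓡 n) p) :
    S.normB p * mvfderiv (𝓡 n) S.normB p u =
      ∑ i, ∑ j, ⟪S.secondFundamentalForm p (S.frame p i) (S.frame p j),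
          S.nablaB p u (S.frame p i) (S.frame p j)⟫ := by
  have h1 := (S.mvfderiv_sum_norm_sq p).2 u
  have h2 : (fun q ↦ ∑ i, ∑ j, ‖S.secondFundamentalForm q (S.frame q i) (S.frame q j)‖ ^ 2) =
      S.normB * S.normB := by
    funext q
    rw [← S.normB_sq, Pi.mul_apply, sq]
  rw [h2, mvfderiv_mul h h] at h1
  have h3 : S.normB p * mvfderiv (𝓡 n) S.normB p u + S.normB p * mvfderiv (𝓡 n) S.normB p u =
      _ := h1
  linarith

theorem mvfderiv_normB_eq_zero (h : MDifferentiableAt (𝓡 n) 𝓘(ℝ, ℝ) S.normB p)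
    (h0 : S.normB p = 0) (u : TangentSpace (𝓡 n) p) : mvfderiv (𝓡 n) S.normB p u = 0 := by
  have hp := mem_chart_source (EuclideanSpace ℝ (Fin n)) p
  rw [(mdifferentiableAt_and_mvfderiv_of_eventuallyEq hp
    (differentiableAt_comp_extChartAt_symm hp h) (eventuallyEq_comp_extChartAt hp S.normB)).2]
  have hmin : IsLocalMin (S.normB ∘ (extChartAt (𝓡 n) p).symm) (extChartAt (𝓡 n) p p) :=
    Filter.Eventually.of_forall fun x ↦ by
      rw [comp_extChartAt_symm_apply hp, h0]
      exact Real.sqrt_nonneg _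
  rw [hmin.fderiv_eq_zero]
  rfl

theorem refined_kato (hn : 1 ≤ n) {ε : ℝ} (hε : 0 < ε)
    (h : MDifferentiableAt (𝓡 n) 𝓘(ℝ, ℝ) S.normB p) :
    (1 + 2 / ((n : ℝ) + ε)) * S.normSqGrad S.normB p
          - 2 * ((n : ℝ) - 1 + ε) / (ε * ((n : ℝ) + ε)) * S.normSqNablaH p
        ≤ S.normSqNablaB p := by
  rw [sub_le_iff_le_add]
  simp only [normSqNablaH, S.normalConnection_meanCurvature]
  by_cases h0 : S.normB p = 0
  · have hn' : (0 : ℝ) ≤ n - 1 := by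
      have : (1 : ℝ) ≤ n := by exact_mod_cast hn
      linarith
    have h1 : S.normSqGrad S.normB p = 0 :=
      Finset.sum_eq_zero fun k _ ↦ by rw [S.mvfderiv_normB_eq_zero h h0, sq, mul_zero]
    rw [h1, mul_zero]
    refine add_nonneg (Finset.sum_nonneg fun _ _ ↦ Finset.sum_nonneg fun _ _ ↦
      Finset.sum_nonneg fun _ _ ↦ sq_nonneg _) (mul_nonneg (by positivity)
      (Finset.sum_nonneg fun _ _ ↦ sq_nonneg _))
  · exact symmetric_tensor_kato
      (fun k i j ↦ S.nablaB p (S.frame p k) (S.frame p i) (S.frame p j))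
      (fun _ _ _ ↦ S.nablaB_swap_left _ _ _) (fun _ _ _ ↦ S.nablaB_swap_right _ _ _) hε hn
      (fun i j ↦ S.secondFundamentalForm p (S.frame p i) (S.frame p j)) (S.normB p) h0
      (S.normB_sq p).symm (fun k ↦ mvfderiv (𝓡 n) S.normB p (S.frame p k))
      (fun k ↦ S.normB_mul_mvfderiv_normB h _)

theorem refined_kato_of_parallel (hn : 1 ≤ n) (hH : S.HasParallelMeanCurvature)
    (h : MDifferentiableAt (𝓡 n) 𝓘(ℝ, ℝ) S.normB p) :
    (1 + 2 / (n : ℝ)) * S.normSqGrad S.normB p ≤ S.normSqNablaB p := by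
  have hn' : (n : ℝ) + 0 ≠ 0 := by
    rw [add_zero]
    exact_mod_cast (by omega : n ≠ 0)
  have hzero : S.normSqNablaH p = 0 :=
    Finset.sum_eq_zero fun k _ ↦ by rw [hH, norm_zero, sq, mul_zero]
  -- `C(n, ε)` may blow up as `ε → 0⁺`, but it multiplies `|∇H|² = 0`; only the leading coefficient
  -- passes to the limit.
  have hlim : Filter.Tendsto (fun ε : ℝ ↦ (1 + 2 / ((n : ℝ) + ε)) * S.normSqGrad S.normB p)
      (nhdsWithin 0 (Set.Ioi 0)) (nhds ((1 + 2 / ((n : ℝ) + 0)) * S.normSqGrad S.normB p)) := by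
    have : ContinuousAt (fun ε : ℝ ↦ (1 + 2 / ((n : ℝ) + ε)) * S.normSqGrad S.normB p) 0 := by
      fun_prop (disch := exact hn')
    exact this.tendsto.mono_left nhdsWithin_le_nhds
  rw [add_zero] at hlim
  refine le_of_tendsto hlim ?_
  filter_upwards [self_mem_nhdsWithin] with ε hε
  have := S.refined_kato hn hε h
  rwa [hzero, mul_zero, sub_zero] at this

end ImmersedSubmanifold

theorem lemma2p2 {n m : ℕ} (hn : 1 ≤ n) {M : Type*} [TopologicalSpace M]
    [ChartedSpace (EuclideanSpace ℝ (Fin n)) M] [IsManifold (𝓡 n) ∞ M]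
    (S : ImmersedSubmanifold n m M) :
    (∀ p : M, S.normB p ≠ 0 → MDifferentiableAt (𝓡 n) 𝓘(ℝ, ℝ) S.normB p) ∧
    (∀ ε : ℝ, 0 < ε → ∀ p : M, MDifferentiableAt (𝓡 n) 𝓘(ℝ, ℝ) S.normB p →
      (1 + 2 / ((n : ℝ) + ε)) * S.normSqGrad S.normB p
          - 2 * ((n : ℝ) - 1 + ε) / (ε * ((n : ℝ) + ε)) * S.normSqNablaH p
        ≤ S.normSqNablaB p) ∧
    (S.HasParallelMeanCurvature →
      ∀ p : M, MDifferentiableAt (𝓡 n) 𝓘(ℝ, ℝ) S.normB p →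
        (1 + 2 / (n : ℝ)) * S.normSqGrad S.normB p ≤ S.normSqNablaB p) :=
  ⟨fun _ h ↦ S.mdifferentiableAt_normB h, fun _ hε _ h ↦ S.refined_kato hn hε h,
    fun hH _ h ↦ S.refined_kato_of_parallel hn hH h⟩
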